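/- Let $\Sigma$ be a finite nonempty alphabet and let $\mathcal A=(Q,\delta,I,F)$ be a nondeterministic Büchi automaton over $\Sigma$ with $n=|Q|<\infty$ that is complete, i.e. $\delta(q,a)\neq\emptyset$ for all $q\in Q$, $a\in\Sigma$. Put $\delta(S,a)=\bigcup_{q\in S}\delta(q,a)$. A Büchi automaton accepts an infinite word iff it has a run on it that starts in an initial state and visits some accepting state infinitely often; its language is the set of the words it accepts. Direct simulation: $p\preceq_{di} r$ iff there is a strategy $\sigma:Q\times(Q\times\Sigma\times Q)\to Q$ (with $\sigma(r',p'\xrightarrow{a}p'')\in\delta(r',a)$ for every transition $p'\xrightarrow{a}p''$) such that for every infinite trace $p=p_0\xrightarrow{a_0}p_1\xrightarrow{a_1}\cdots$ of $\mathcal A$, the sequence $r_0=r$, $r_{i+1}=\sigma(r_i,p_i\xrightarrow{a_i}p_{i+1})$ satisfies $p_i\in F\Rightarrow r_i\in F$ for all $i$. A ranking is a function $f:Q\to\{0,\dots,2n\}$ with even values on $F$, and $\mathrm{rank}(f)=\max_q f(q)$. It is $S$-tight, for $S\subseteq Q$, if $r=\mathrm{rank}(f)$ is odd, $\{1,3,\dots,r\}\subseteq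 f(S)$, and $f(q)=0$ for all $q\notin S$; it is tight if it is $Q$-tight. Let $Q_1=2^Q$ and let $Q_2$ be the set of all $(S,O,f,i)$ such that $S,O\subseteq Q$, $f$ is a tight ranking, $i\in\{0,2,\dots,2n-2\}$, $f$ is $S$-tight and $O\subseteq S\cap f^{-1}(i)$. For a set $M\subseteq Q_2$, let $\mathcal B_M$ be the Büchi automaton with states $Q_1\cup M$, initial state $I$, accepting states $\emptyset\in Q_1$ and all $(S,\emptyset,f,i)\in M$, and exactly the following transitions over $a\in\Sigma$: - $S\to\delta(S,a)$ for $S\in Q_1$; - $S\to(\delta(S,a),\emptyset,f,0)\in M$ for $S\in Q_1$ and $f$ that is $\delta(S,a)$-tight; - $(S,O,f,i)\to(S',O',f',i')$ between elements of $M$ such that $S'=\delta(S,a)$, $f'(q')\le f(q)$ for all $q\in S$ and $q'\in\delta(q,a)$, $\mathrm{rank}(f)=\mathrm{rank}(f')$, $f'$ is $S'$-tight, and either $O=\emptyset$, $i'=(i+2)\bmod(\mathrm{rank}(f')+1)$ and $O'=S'\cap f'^{-1}(i')$, or $O\ne\emptyset$, $i'=i$ and $O'=\delta(O,a)\cap f'^{-1}(i)$.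 Schewe's complement automaton of $\mathcal A$ is $\mathcal B_{Q_2}$. Let $Q_2^{di}$ be $Q_2$ without all macrostates $(S,O,f,i)$ for which there are $p,q\in S$ with $p\preceq_{di}q$ and $f(p)>f(q)$. Then the purged automaton $\mathcal B_{Q_2^{di}}$ satisfies $$L(\mathcal B_{Q_2^{di}})=L(\mathcal B_{Q_2}).$$ -/

import Mathlib

/-- A nondeterministic Büchi automaton over the alphabet `α` with state space `Q`
(finiteness of `α` and `Q` is supplied by type-class hypotheses where it is used). -/
structure BuchiAutomaton (α : Type*) (Q : Type*) where
  /-- transition function -/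
  δ : Q → α → Set Q
  /-- initial states -/
  I : Set Q
  /-- accepting states -/
  F : Set Q

/-- A macrostate `(S, O, f, i)` of the second part of the complement automaton
(before any condition is imposed on its components). -/
@[ext]
structure Macrostate (Q : Type*) where
  S : Set Q
  O : Set Q
  f : Q → ℕ
  i : ℕ

namespace BuchiAutomaton

section Basic

variable {α Q : Type*} (A : BuchiAutomaton α Q)

/-- Every state has a successor under every symbol. -/
def IsComplete : Prop := ∀ q a, (A.δ q a).Nonempty

/-- The extension of `δ` to sets of states. -/
def post (S : Set Q) (a : α) : Set Q := ⋃ q ∈ S, A.δ q a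

/-- `ρ` is a run from `q` on the infinite word `w`. -/
def IsRun (w : ℕ → α) (q : Q) (ρ : ℕ → Q) : Prop :=
  ρ 0 = q ∧ ∀ i, ρ (i + 1) ∈ A.δ (ρ i) (w i)

/-- Some accepting state occurs infinitely often in `ρ`. -/
def IsAccepting (ρ : ℕ → Q) : Prop := ∃ q ∈ A.F, {i | ρ i = q}.Infinite

/-- The language of a state. -/
def languageFrom (q : Q) : Set (ℕ → α) := {w | ∃ ρ, A.IsRun w q ρ ∧ A.IsAccepting ρ}

/-- The language of the automaton. -/
def language : Set (ℕ → α) := ⋃ q ∈ A.I, A.languageFrom q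

/-- `σ` is a strategy of Duplicator: when Duplicator is in `r` and Spoiler takes the transition
from `p` to `p'` over `a`, Duplicator moves to `σ r p a p'`, which is an `a`-successor of `r`. -/
def IsStrategy (σ : Q → Q → α → Q → Q) : Prop :=
  ∀ r p a p', p' ∈ A.δ p a → σ r p a p' ∈ A.δ r a

/-- The sequence of states that Duplicator visits from `r` under the strategy `σ` while Spoiler
takes the trace with states `π` over the word `w`. -/
def response (σ : Q → Q → α → Q → Q) (r : Q) (w : ℕ → α) (π : ℕ → Q) : ℕ → Q
  | 0 => r
  | i + 1 => σ (response σ r w π i) (π i) (w i) (π (i + 1))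

/-- The maximal direct simulation: `p` is directly simulated by `r` iff Duplicator has a winning
strategy from `(p, r)` in the game in which Duplicator must be in an accepting state whenever
Spoiler is. -/
def DirectSim (p r : Q) : Prop :=
  ∃ σ, A.IsStrategy σ ∧ ∀ w π, A.IsRun w p π →
    ∀ i, π i ∈ A.F → response σ r w π i ∈ A.F

end Basic

section Complement

variable {α Q : Type*} [Fintype Q] (A : BuchiAutomaton α Q)

/-- `f` is a level ranking: its values lie in `{0, …, 2n}`, where `n` is the number of states,
and accepting states get even values. -/
def IsRanking (f : Q → ℕ) : Prop :=
  (∀ q, f q ≤ 2 * Fintype.card Q) ∧ ∀ q ∈ A.F, Even (f q)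

/-- The rank of a ranking, i.e. its maximal value. -/
def rank (f : Q → ℕ) : ℕ := Finset.univ.sup f

/-- `f` is `S`-tight: its rank is odd, every odd number up to the rank is attained on `S`, and
all states outside `S` have value `0`. -/
def IsTightOn (S : Set Q) (f : Q → ℕ) : Prop :=
  Odd (rank f) ∧ (∀ k, Odd k → k ≤ rank f → ∃ s ∈ S, f s = k) ∧ ∀ q ∉ S, f q = 0

/-- The set of tight rankings. -/
def tightRankings : Set (Q → ℕ) := {f | A.IsRanking f ∧ IsTightOn Set.univ f}

/-- `f'` does not exceed `f` along the `a`-transitions that leave `S`. -/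
def RankLE (S : Set Q) (a : α) (f' f : Q → ℕ) : Prop :=
  ∀ q ∈ S, ∀ q' ∈ A.δ q a, f' q' ≤ f q

/-- The macrostates `(S, O, f, i)` of the complement automaton: `f` is a tight ranking,
`i ∈ {0, 2, …, 2n - 2}`, `f` is `S`-tight and `O ⊆ S ∩ f⁻¹(i)`. -/
def Q₂ : Set (Macrostate Q) :=
  {m | m.f ∈ A.tightRankings ∧ Even m.i ∧ m.i + 2 ≤ 2 * Fintype.card Q ∧
    IsTightOn m.S m.f ∧ m.O ⊆ m.S ∩ m.f ⁻¹' {m.i}}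

/-- The condition for a transition over `a` between two macrostates. -/
def macroStep (m : Macrostate Q) (a : α) (m' : Macrostate Q) : Prop :=
  m'.S = A.post m.S a ∧ A.RankLE m.S a m'.f m.f ∧ rank m.f = rank m'.f ∧
    IsTightOn m'.S m'.f ∧
    ((m.O = ∅ ∧ m'.i = (m.i + 2) % (rank m'.f + 1) ∧ m'.O = m'.S ∩ m'.f ⁻¹' {m'.i}) ∨
      (m.O ≠ ∅ ∧ m'.i = m.i ∧ m'.O = A.post m.O a ∩ m'.f ⁻¹' {m.i}))

/-- The transition relation of Schewe's construction in which the set `M` is used as the second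
part of the state space. -/
def scheweStep (M : Set (Macrostate Q)) : Set Q ⊕ M → α → Set Q ⊕ M → Prop
  | .inl S, a, .inl S' => S' = A.post S a
  | .inl S, a, .inr m' =>
      m'.1.S = A.post S a ∧ m'.1.O = ∅ ∧ IsTightOn m'.1.S m'.1.f ∧ m'.1.i = 0
  | .inr m, a, .inr m' => A.macroStep m.1 a m'.1
  | .inr _, _, .inl _ => False

/-- Schewe's construction in which the set `M` is used as the second part of the state space;
the first part consists of all sets of states. -/
def scheweWith (M : Set (Macrostate Q)) : BuchiAutomaton α (Set Q ⊕ M) where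
  δ x a := {y | A.scheweStep M x a y}
  I := {.inl A.I}
  F := {.inl ∅} ∪ {x | ∃ m : M, x = .inr m ∧ m.1.O = ∅}

/-- The complement automaton of Schewe. -/
def compSchewe : BuchiAutomaton α (Set Q ⊕ A.Q₂) := A.scheweWith A.Q₂

/-- The macrostates to be purged: some `p, q ∈ S` are such that `p` is directly simulated by `q`
although the value of `p` exceeds that of `q`. -/
def PurgedDi (m : Macrostate Q) : Prop :=
  ∃ p ∈ m.S, ∃ q ∈ m.S, A.DirectSim p q ∧ m.f p > m.f q

/-- The macrostates that survive the purging. -/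
def Q₂Di : Set (Macrostate Q) := A.Q₂ \ {m ∈ A.Q₂ | A.PurgedDi m}

/-- The purged complement automaton: Schewe's construction with every occurrence of the set of
macrostates replaced by the set of surviving macrostates. -/
def purgeDi : BuchiAutomaton α (Set Q ⊕ A.Q₂Di) := A.scheweWith A.Q₂Di

/-- There are finitely many macrostates. -/
theorem finite_Q₂ : A.Q₂.Finite := by
  have h1 : (Set.univ.pi fun _ : Q => Set.Iic (2 * Fintype.card Q)).Finite :=
    Set.Finite.pi fun _ => Set.finite_Iic _
  have h2 : (Set.univ ×ˢ (Set.univ ×ˢ ((Set.univ.pi fun _ : Q => Set.Iic (2 * Fintype.card Q)) ×ˢ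
      Set.Iic (2 * Fintype.card Q))) : Set (Set Q × Set Q × (Q → ℕ) × ℕ)).Finite :=
    Set.finite_univ.prod (Set.finite_univ.prod (h1.prod (Set.finite_Iic _)))
  refine (h2.image fun x => Macrostate.mk x.1 x.2.1 x.2.2.1 x.2.2.2).subset ?_
  rintro m ⟨hf, -, hi, -⟩
  refine ⟨(m.S, m.O, m.f, m.i), ?_, rfl⟩
  simp only [Set.mem_prod, Set.mem_univ, Set.mem_pi, Set.mem_Iic, true_and]
  exact ⟨fun q _ => hf.1.1 q, by omega⟩

/-- The complement automaton has finitely many states. -/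
instance : Finite A.Q₂ := A.finite_Q₂

/-- The purged complement automaton has finitely many states. -/
instance : Finite A.Q₂Di := A.finite_Q₂.subset Set.sdiff_subset

end Complement

end BuchiAutomaton

/-!
The inclusion from left to right holds because removing macrostates only removes runs.

For the converse, view rankings as functions on the run graph of `A` on the given word `w`. An
accepting run of the complement automaton that enters its second part yields an *odd ranking*
(`IsOddRanking`): values do not increase along edges, accepting vertices have even values, and no
infinite path is trapped in an even value. Odd rankings are closed under pointwise infima, so there
is a least one, `leastRanking`, and three facts about it give an accepting run of the purged
automaton.

* It is monotone for direct simulation (`leastRanking_le_of_directSim`). Indeed, for an odd ranking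
  `f`, the function that maps `q` to the minimum of `f p` over the vertices `p` of the same level
  that simulate `q` is an odd ranking again (`IsOddRanking.minSim`), hence not below the least one.
* It is tight in almost all levels (`eventually_tight_leastRanking`). If no path were trapped in
  some odd value below the maximum, then this value could be collapsed, which contradicts
  minimality; that the maximum is odd in the long run follows from Kőnig's lemma.
* It is bounded by the odd ranking obtained from the given run, hence by `2n`.

From a level on in which the least odd ranking is tight, the breakpoint construction
(`breakpointRun`) gives a run of macrostates, none of which is purged, by monotonicity. Its
breakpoint set is emptied infinitely often, as otherwise Kőnig's lemma would yield a path that is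
trapped in an even value.

A run that never enters the second part is a run of both automata.
-/

namespace BuchiAutomaton

/-! ### Run graph and odd rankings -/

section RunGraph

variable {α Q : Type*} (A : BuchiAutomaton α Q)

/-- The set of states reachable after reading the first `k` letters of `w`: the `k`-th level of the
run graph of `A` on `w`. -/
def reach (w : ℕ → α) : ℕ → Set Q
  | 0 => A.I
  | k + 1 => A.post (reach w k) (w k)

/-- `τ` is an infinite path of the run graph from level `N` on. The index of `τ` is the level in
the run graph; the values of `τ` below `N` are irrelevant. -/
def IsPathFrom (w : ℕ → α) (N : ℕ) (τ : ℕ → Q) : Prop :=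
  ∀ k ≥ N, τ k ∈ A.reach w k ∧ τ (k + 1) ∈ A.δ (τ k) (w k)

/-- An odd ranking of the run graph of `A` on `w`: values do not increase along edges, accepting
vertices have even values, and no infinite path is trapped in an even value. Nothing is required
of the values off the run graph, and there is no bound on the values. -/
structure IsOddRanking (w : ℕ → α) (f : ℕ → Q → ℕ) : Prop where
  le_of_edge : ∀ k, ∀ q ∈ A.reach w k, ∀ q' ∈ A.δ q (w k), f (k + 1) q' ≤ f k q
  even_of_mem : ∀ k, ∀ q ∈ A.reach w k, q ∈ A.F → Even (f k q)
  odd_of_path : ∀ N τ v, A.IsPathFrom w N τ → (∀ k ≥ N, f k (τ k) = v) → Odd v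

/-- The pointwise infimum of all odd rankings. -/
noncomputable def leastRanking (w : ℕ → α) (k : ℕ) (q : Q) : ℕ :=
  sInf {v | ∃ f, A.IsOddRanking w f ∧ f k q = v}

variable {A} {w : ℕ → α}

theorem mem_post {S : Set Q} {a : α} {q' : Q} : q' ∈ A.post S a ↔ ∃ q ∈ S, q' ∈ A.δ q a := by
  simp [post]

theorem mem_reach_succ {k : ℕ} {q q' : Q} (hq : q ∈ A.reach w k) (h : q' ∈ A.δ q (w k)) :
    q' ∈ A.reach w (k + 1) :=
  mem_post.2 ⟨q, hq, h⟩

theorem IsPathFrom.mono {N N' : ℕ} {τ : ℕ → Q} (h : A.IsPathFrom w N τ) (hN : N ≤ N') :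
    A.IsPathFrom w N' τ :=
  fun k hk => h k (hN.trans hk)

/-- A sequence of naturals that is non-increasing from `N` on is eventually constant. -/
theorem exists_forall_eq_of_succ_le {g : ℕ → ℕ} {N : ℕ} (h : ∀ k ≥ N, g (k + 1) ≤ g k) :
    ∃ K ≥ N, ∀ k ≥ K, g k = g K := by
  have hne : (g '' Set.Ici N).Nonempty := ⟨g N, N, le_refl N, rfl⟩
  obtain ⟨K, hK, hgK⟩ := Nat.sInf_mem hne
  refine ⟨K, hK, fun k hk => le_antisymm ?_ ?_⟩
  · induction k, hk using Nat.le_induction with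
    | base => exact le_rfl
    | succ k hk ih => exact (h k (le_trans hK hk)).trans ih
  · rw [hgK]
    exact Nat.sInf_le ⟨k, le_trans hK hk, rfl⟩

/-- Dependent choice: if every vertex of `T` has a successor in `T`, then `T` contains an infinite
path from each of its vertices. -/
theorem exists_path_of_forall_exists_succ {T : ℕ → Set Q} {N : ℕ} {q : Q} (hq : q ∈ T N)
    (h : ∀ k ≥ N, ∀ p ∈ T k, ∃ p' ∈ A.δ p (w k), p' ∈ T (k + 1)) :
    ∃ τ : ℕ → Q, ∀ k ≥ N, τ k ∈ T k ∧ τ (k + 1) ∈ A.δ (τ k) (w k) := by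
  choose! s hs hsT using h
  let σ : ℕ → Q := fun j => Nat.rec q (fun j p => s (N + j) p) j
  have hσ : ∀ j, σ j ∈ T (N + j) := by
    intro j
    induction j with
    | zero => exact hq
    | succ j ih => exact hsT (N + j) (Nat.le_add_right _ _) _ ih
  refine ⟨fun k => σ (k - N), fun k hk => ?_⟩
  obtain ⟨j, rfl⟩ := Nat.exists_eq_add_of_le hk
  have e : N + j + 1 - N = j + 1 := by omega
  simp only [e, Nat.add_sub_cancel_left]
  exact ⟨hσ j, hs (N + j) hk _ (hσ j)⟩

/-- Kőnig's lemma: if the sets `T k` are nonempty and every vertex of `T (k + 1)` has a predecessor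
in `T k`, then there is an infinite path through the sets `T k`. -/
theorem exists_path_of_forall_exists_pred [Finite Q] {T : ℕ → Set Q} {N : ℕ}
    (hne : ∀ k ≥ N, (T k).Nonempty) (h : ∀ k ≥ N, T (k + 1) ⊆ A.post (T k) (w k)) :
    ∃ τ : ℕ → Q, ∀ k ≥ N, τ k ∈ T k ∧ τ (k + 1) ∈ A.δ (τ k) (w k) := by
  -- The sequences that are paths up to level `N + l` form a decreasing family of nonempty closed
  -- subsets of the compact space `ℕ → Q`.
  let : TopologicalSpace Q := ⊥
  have : DiscreteTopology Q := ⟨rfl⟩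
  let C : ℕ → Set (ℕ → Q) := fun l =>
    {τ | ∀ k ≥ N, k < N + l → τ k ∈ T k ∧ τ (k + 1) ∈ A.δ (τ k) (w k)}
  have hCne : ∀ l, ∀ q ∈ T (N + l), ∃ τ ∈ C l, τ (N + l) = q := by
    intro l
    induction l with
    | zero => exact fun q _ => ⟨fun _ => q, fun k h1 h2 => by omega, rfl⟩
    | succ l ih =>
      intro q' hq'
      obtain ⟨q, hq, hqq'⟩ := mem_post.1 (h (N + l) (Nat.le_add_right _ _) hq')
      obtain ⟨τ, hτ, rfl⟩ := ih q hq
      refine ⟨Function.update τ (N + (l + 1)) q', fun k h1 h2 => ?_, by simp⟩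
      rw [Function.update_of_ne (by omega)]
      rcases Nat.lt_or_ge k (N + l) with hk | hk
      · rw [Function.update_of_ne (by omega)]
        exact hτ k h1 hk
      · obtain rfl : k = N + l := by omega
        exact ⟨hq, by simpa [add_assoc] using hqq'⟩
  have hclosed : ∀ l, IsClosed (C l) := by
    intro l
    have : C l = ⋂ k, ⋂ (_ : k ≥ N), ⋂ (_ : k < N + l),
        (fun τ : ℕ → Q => (τ k, τ (k + 1))) ⁻¹' {x | x.1 ∈ T k ∧ x.2 ∈ A.δ x.1 (w k)} := by
      ext τ
      simp [C]
    rw [this]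
    refine isClosed_iInter fun k => isClosed_iInter fun _ => isClosed_iInter fun _ => ?_
    exact (isClosed_discrete _).preimage (by fun_prop)
  obtain ⟨τ, hτ⟩ := IsCompact.nonempty_iInter_of_sequence_nonempty_isCompact_isClosed C
    (fun l τ hτ k h1 h2 => hτ k h1 (by omega))
    (fun l => by
      obtain ⟨q, hq⟩ := hne (N + l) (Nat.le_add_right _ _)
      obtain ⟨τ, hτ, -⟩ := hCne l q hq
      exact ⟨τ, hτ⟩)
    (hclosed 0).isCompact hclosed
  exact ⟨τ, fun k hk => Set.mem_iInter.1 hτ (k + 1) k hk (by omega)⟩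

/-! ### The least odd ranking -/

theorem IsOddRanking.le_of_path {f : ℕ → Q → ℕ} (hf : A.IsOddRanking w f) {N : ℕ} {τ : ℕ → Q}
    (hτ : A.IsPathFrom w N τ) : ∀ k ≥ N, f (k + 1) (τ (k + 1)) ≤ f k (τ k) :=
  fun k hk => hf.le_of_edge k _ (hτ k hk).1 _ (hτ k hk).2

theorem leastRanking_le {f : ℕ → Q → ℕ} (hf : A.IsOddRanking w f) (k : ℕ) (q : Q) :
    A.leastRanking w k q ≤ f k q :=
  Nat.sInf_le ⟨f, hf, rfl⟩

theorem exists_eq_leastRanking (hex : ∃ f, A.IsOddRanking w f) (k : ℕ) (q : Q) :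
    ∃ f, A.IsOddRanking w f ∧ f k q = A.leastRanking w k q := by
  obtain ⟨f, hf⟩ := hex
  exact Nat.sInf_mem (s := {v | ∃ f, A.IsOddRanking w f ∧ f k q = v}) ⟨_, f, hf, rfl⟩

theorem isOddRanking_leastRanking (hex : ∃ f, A.IsOddRanking w f) :
    A.IsOddRanking w (A.leastRanking w) where
  le_of_edge k q hq q' hq' := by
    obtain ⟨f, hf, e⟩ := exists_eq_leastRanking hex k q
    rw [← e]
    exact (leastRanking_le hf _ _).trans (hf.le_of_edge k q hq q' hq')
  even_of_mem k q hq hF := by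
    obtain ⟨f, hf, e⟩ := exists_eq_leastRanking hex k q
    rw [← e]
    exact hf.even_of_mem k q hq hF
  odd_of_path N τ v hτ hv := by
    -- An odd ranking that attains the infimum at the start of the path is squeezed to be constant.
    obtain ⟨f, hf, e⟩ := exists_eq_leastRanking hex N (τ N)
    refine hf.odd_of_path N τ v hτ fun k hk => le_antisymm ?_ ?_
    · induction k, hk using Nat.le_induction with
      | base => rw [e, hv N le_rfl]
      | succ k hk ih => exact (hf.le_of_path hτ k hk).trans ih
    · rw [← hv k hk]
      exact leastRanking_le hf _ _

open Classical in
theorem IsOddRanking.indicator {f : ℕ → Q → ℕ} (hf : A.IsOddRanking w f) :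
    A.IsOddRanking w fun k q => if q ∈ A.reach w k then f k q else 0 where
  le_of_edge k q hq q' hq' := by
    simpa [hq, mem_reach_succ hq hq'] using hf.le_of_edge k q hq q' hq'
  even_of_mem k q hq hF := by simpa [hq] using hf.even_of_mem k q hq hF
  odd_of_path N τ v hτ hv :=
    hf.odd_of_path N τ v hτ fun k hk => by simpa [(hτ k hk).1] using hv k hk

theorem leastRanking_eq_zero (hex : ∃ f, A.IsOddRanking w f) {k : ℕ} {q : Q}
    (hq : q ∉ A.reach w k) : A.leastRanking w k q = 0 := by
  obtain ⟨f, hf⟩ := hex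
  simpa [hq] using leastRanking_le hf.indicator k q

/-- Every odd value that the least odd ranking reaches or exceeds somewhere is the value in which
some infinite path is trapped, so that it occurs in almost all levels. Otherwise the two values `c`
and `c + 1` could be collapsed to `c - 1`, and the values above them lowered by `2`, which would
give a smaller odd ranking. -/
theorem eventually_exists_leastRanking_eq (hex : ∃ f, A.IsOddRanking w f) {c : ℕ} (hc : Odd c)
    {k₀ : ℕ} {q₀ : Q} (hle : c ≤ A.leastRanking w k₀ q₀) :
    ∀ᶠ k in Filter.atTop, ∃ s ∈ A.reach w k, A.leastRanking w k s = c := by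
  have hμ := isOddRanking_leastRanking hex
  by_cases hp : ∃ N τ, A.IsPathFrom w N τ ∧ ∀ k ≥ N, A.leastRanking w k (τ k) = c
  · obtain ⟨N, τ, hτ, h⟩ := hp
    exact Filter.eventually_atTop.2 ⟨N, fun k hk => ⟨τ k, (hτ k hk).1, h k hk⟩⟩
  · exfalso
    let φ : ℕ → ℕ := fun v => if v < c then v else if v ≤ c + 1 then c - 1 else v - 2
    have hφ : A.IsOddRanking w fun k q => φ (A.leastRanking w k q) := by
      refine ⟨fun k q hq q' hq' => ?_, fun k q hq hF => ?_, fun N τ v hτ hv => ?_⟩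
      · have := hμ.le_of_edge k q hq q' hq'
        simp only [φ]
        split_ifs <;> omega
      · have := hμ.even_of_mem k q hq hF
        simp only [φ]
        split_ifs <;> grind
      · obtain ⟨K, hK, hconst⟩ := exists_forall_eq_of_succ_le
          (g := fun k => A.leastRanking w k (τ k)) (hμ.le_of_path hτ)
        have hodd := hμ.odd_of_path K τ _ (hτ.mono hK) hconst
        have hnec : A.leastRanking w K (τ K) ≠ c := fun e =>
          hp ⟨K, τ, hτ.mono hK, fun k hk => (hconst k hk).trans e⟩
        rw [← hv K hK]
        simp only [φ]
        split_ifs <;> grind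
    have := leastRanking_le hφ k₀ q₀
    have hpos := hc.pos
    simp only [φ] at this
    split_ifs at this <;> omega

/-- In almost all levels the least odd ranking has the same odd rank and is tight. -/
theorem eventually_tight_leastRanking [Fintype Q] (hex : ∃ f, A.IsOddRanking w f)
    (hne : ∀ k, (A.reach w k).Nonempty) :
    ∃ r, ∀ᶠ k in Filter.atTop, rank (A.leastRanking w k) = r ∧
      IsTightOn (A.reach w k) (A.leastRanking w k) := by
  have hμ := isOddRanking_leastRanking hex
  have hle : ∀ k q, A.leastRanking w k q ≤ rank (A.leastRanking w k) := fun k q =>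
    Finset.le_sup (f := A.leastRanking w k) (Finset.mem_univ q)
  have hanti : ∀ k ≥ 0, rank (A.leastRanking w (k + 1)) ≤ rank (A.leastRanking w k) := by
    refine fun k _ => Finset.sup_le fun q' _ => ?_
    by_cases hq' : q' ∈ A.reach w (k + 1)
    · obtain ⟨q, hq, hqq'⟩ := mem_post.1 hq'
      exact (hμ.le_of_edge k q hq q' hqq').trans (hle k q)
    · simp [leastRanking_eq_zero hex hq']
  obtain ⟨K, -, hK⟩ := exists_forall_eq_of_succ_le
    (g := fun k => rank (A.leastRanking w k)) hanti
  set r := rank (A.leastRanking w K) with hr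
  have hattain : ∀ k, ∃ s ∈ A.reach w k, A.leastRanking w k s = rank (A.leastRanking w k) := by
    intro k
    obtain ⟨s, hs⟩ := hne k
    obtain ⟨q, -, hq⟩ := Finset.exists_mem_eq_sup Finset.univ ⟨s, Finset.mem_univ s⟩
      (A.leastRanking w k)
    by_cases hqr : q ∈ A.reach w k
    · exact ⟨q, hqr, hq.symm⟩
    · rw [leastRanking_eq_zero hex hqr] at hq
      have := hle k s
      exact ⟨s, hs, le_antisymm this (by rw [rank, hq]; exact Nat.zero_le _)⟩
  -- The vertices of maximal value form an infinite finitely branching graph.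
  have hodd : Odd r := by
    obtain ⟨τ, hτ⟩ := exists_path_of_forall_exists_pred (A := A) (w := w) (N := K)
      (T := fun k => {q | q ∈ A.reach w k ∧ A.leastRanking w k q = r})
      (fun k hk => by
        obtain ⟨s, hs, e⟩ := hattain k
        exact ⟨s, hs, e.trans (hK k hk)⟩)
      (fun k hk q' hq' => by
        obtain ⟨q, hq, hqq'⟩ := mem_post.1 hq'.1
        refine mem_post.2 ⟨q, ⟨hq, le_antisymm ?_ ?_⟩, hqq'⟩
        · exact (hle k q).trans (hK k hk).le
        · rw [← hq'.2]
          exact hμ.le_of_edge k q hq q' hqq')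
    exact hμ.odd_of_path K τ r (fun k hk => ⟨(hτ k hk).1.1, (hτ k hk).2⟩)
      (fun k hk => (hτ k hk).1.2)
  have hall : ∀ᶠ k in Filter.atTop, ∀ c ∈ Set.Iic r, Odd c →
      ∃ s ∈ A.reach w k, A.leastRanking w k s = c := by
    refine (Filter.eventually_all_finite (Set.finite_Iic r)).2 fun c hc => ?_
    obtain ⟨s, -, e⟩ := hattain K
    by_cases hco : Odd c
    · filter_upwards [eventually_exists_leastRanking_eq hex hco (hc.trans e.ge)] with k hk _
      exact hk
    · exact Filter.Eventually.of_forall fun k h => absurd h hco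
  refine ⟨r, ?_⟩
  filter_upwards [hall, Filter.eventually_ge_atTop K] with k hk hkK
  refine ⟨hK k hkK, by rwa [hK k hkK], fun c hc hcr => hk c ?_ hc, fun q hq =>
    leastRanking_eq_zero hex hq⟩
  rwa [hK k hkK] at hcr

/-! ### Direct simulation -/

theorem IsComplete.exists_isRun (hA : A.IsComplete) (w : ℕ → α) (q : Q) : ∃ π, A.IsRun w q π := by
  choose s hs using hA
  exact ⟨fun j => Nat.rec q (fun j p => s p (w j)) j, rfl, fun i => hs _ _⟩

theorem DirectSim.refl (hA : A.IsComplete) (q : Q) : A.DirectSim q q := by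
  classical
  choose s hs using hA
  -- Duplicator copies Spoiler's move whenever that is possible.
  refine ⟨fun r _ a p' => if p' ∈ A.δ r a then p' else s r a, fun r p a p' _ => ?_, ?_⟩
  · dsimp only
    split_ifs with h
    exacts [h, hs r a]
  · rintro w π ⟨h0, hπ⟩
    have key : ∀ i, response (fun r _ a p' => if p' ∈ A.δ r a then p' else s r a) q w π i = π i := by
      intro i
      induction i with
      | zero => exact h0.symm
      | succ i ih => simp [response, ih, hπ i]
    exact fun i hi => by rwa [key]

/-- Completeness matters here: the winning condition speaks of infinite traces only, so it says
nothing about a state from which there are none. -/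
theorem DirectSim.mem_of_mem [Nonempty α] (hA : A.IsComplete) {p r : Q} (h : A.DirectSim p r)
    (hp : p ∈ A.F) : r ∈ A.F := by
  obtain ⟨σ, -, hσ⟩ := h
  obtain ⟨π, hπ⟩ := hA.exists_isRun (fun _ => Classical.arbitrary α) p
  exact hσ _ π hπ 0 (by rwa [hπ.1])

theorem DirectSim.exists_succ {p r p' : Q} {a : α} (h : A.DirectSim p r) (hp' : p' ∈ A.δ p a) :
    ∃ r' ∈ A.δ r a, A.DirectSim p' r' := by
  obtain ⟨σ, hs, hσ⟩ := h
  refine ⟨σ r p a p', hs r p a p' hp', σ, hs, fun w π hπ i hi => ?_⟩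
  -- The play from `(p', r')` is the rest of the play from `(p, r)` that starts with `a`.
  let w' : ℕ → α := fun j => Nat.casesOn j a w
  let π' : ℕ → Q := fun j => Nat.casesOn j p π
  have hrun : A.IsRun w' p π' := by
    refine ⟨rfl, fun j => ?_⟩
    cases j with
    | zero =>
      change π 0 ∈ A.δ p a
      rwa [hπ.1]
    | succ j => exact hπ.2 j
  have key : ∀ j, response σ r w' π' (j + 1) = response σ (σ r p a p') w π j := by
    intro j
    induction j with
    | zero => simp [response, w', π', hπ.1]
    | succ j ih => rw [response, ih]; rfl
  rw [← key]
  exact hσ w' π' hrun (i + 1) hi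

/-- Replacing the value of each vertex by the least value of a vertex of the same level that
simulates it keeps an odd ranking odd. -/
theorem IsOddRanking.minSim [Nonempty α] (hA : A.IsComplete) {f : ℕ → Q → ℕ}
    (hf : A.IsOddRanking w f) :
    A.IsOddRanking w fun k q => sInf {v | ∃ p ∈ A.reach w k, A.DirectSim q p ∧ f k p = v} := by
  have hle : ∀ k p q, p ∈ A.reach w k → A.DirectSim q p →
      sInf {v | ∃ p ∈ A.reach w k, A.DirectSim q p ∧ f k p = v} ≤ f k p :=
    fun k p q hp hqp => Nat.sInf_le ⟨p, hp, hqp, rfl⟩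
  have hmem : ∀ k q, q ∈ A.reach w k → ∃ p ∈ A.reach w k, A.DirectSim q p ∧
      f k p = sInf {v | ∃ p ∈ A.reach w k, A.DirectSim q p ∧ f k p = v} :=
    fun k q hq => Nat.sInf_mem (s := {v | ∃ p ∈ A.reach w k, A.DirectSim q p ∧ f k p = v})
      ⟨f k q, q, hq, DirectSim.refl hA q, rfl⟩
  refine ⟨fun k q hq q' hq' => ?_, fun k q hq hF => ?_, fun N τ v hτ hv => ?_⟩
  · obtain ⟨p, hp, hqp, e⟩ := hmem k q hq
    obtain ⟨p', hpp', hqp'⟩ := hqp.exists_succ hq'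
    exact (hle (k + 1) p' q' (mem_reach_succ hp hpp') hqp').trans
      ((hf.le_of_edge k p hp p' hpp').trans e.le)
  · obtain ⟨p, hp, hqp, e⟩ := hmem k q hq
    simpa only [← e] using hf.even_of_mem k p hp (hqp.mem_of_mem hA hF)
  · -- A path trapped in `v` is simulated by a path on which `f` has the constant value `v`.
    obtain ⟨p, hp, hqp, e⟩ := hmem N (τ N) (hτ N le_rfl).1
    obtain ⟨τ', hτ'⟩ := exists_path_of_forall_exists_succ (A := A) (w := w)
      (T := fun k => {p | p ∈ A.reach w k ∧ A.DirectSim (τ k) p ∧ f k p = v})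
      ⟨hp, hqp, e.trans (hv N le_rfl)⟩
      (by
        rintro k hk p ⟨hp, hqp, e⟩
        obtain ⟨p', hpp', hqp'⟩ := hqp.exists_succ (hτ k hk).2
        have hp' := mem_reach_succ hp hpp'
        refine ⟨p', hpp', hp', hqp', le_antisymm ?_ ?_⟩
        · exact (hf.le_of_edge k p hp p' hpp').trans e.le
        · rw [← hv (k + 1) (by omega)]
          exact hle _ _ _ hp' hqp')
    exact hf.odd_of_path N τ' v (fun k hk => ⟨(hτ' k hk).1.1, (hτ' k hk).2⟩)
      (fun k hk => (hτ' k hk).1.2.2)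

theorem leastRanking_le_of_directSim [Nonempty α] (hA : A.IsComplete)
    (hex : ∃ f, A.IsOddRanking w f) {k : ℕ} {p q : Q} (hq : q ∈ A.reach w k)
    (hpq : A.DirectSim p q) : A.leastRanking w k p ≤ A.leastRanking w k q :=
  (leastRanking_le ((isOddRanking_leastRanking hex).minSim hA) k p).trans
    (Nat.sInf_le ⟨q, hq, hpq, rfl⟩)

end RunGraph

/-! ### From accepting runs of the complement automaton to odd rankings -/

section Complement

variable {α Q : Type*} [Fintype Q] {A : BuchiAutomaton α Q} {w : ℕ → α}

/-- If the breakpoint set is emptied infinitely often, then no path is trapped in an even value: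
the counter `i` runs cyclically through all even values up to the rank, and a path trapped in the
value `i` would enter the breakpoint set at the next reset and never leave it. -/
theorem odd_of_macroStep_path {m : ℕ → Macrostate Q} {N : ℕ}
    (hS : ∀ k ≥ N, (m k).S = A.reach w k) (hQ : ∀ k ≥ N, m k ∈ A.Q₂)
    (hstep : ∀ k ≥ N, A.macroStep (m k) (w k) (m (k + 1)))
    (hO : ∀ n, ∃ k ≥ n, (m k).O = ∅) {τ : ℕ → Q} (hτ : A.IsPathFrom w N τ) {v : ℕ}
    (hv : ∀ k ≥ N, (m k).f (τ k) = v) : Odd v := by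
  by_contra hodd
  have heven : Even v := Nat.not_odd_iff_even.1 hodd
  obtain ⟨a, ha, hOa⟩ := hO N
  set r := rank (m a).f with hr
  have hrank : ∀ k ≥ a, rank (m k).f = r := by
    intro k hk
    induction k, hk using Nat.le_induction with
    | base => rfl
    | succ k hk ih => rw [← (hstep k (ha.trans hk)).2.2.1, ih]
  have hrodd : Odd r := (hQ a ha).2.2.2.1.1
  have hia : Even (m a).i := (hQ a ha).2.1
  have hvr : v ≤ r := by
    rw [← hv a ha]
    exact Finset.le_sup (f := (m a).f) (Finset.mem_univ _)
  -- The `j`-th reset after level `a` sets the counter to `(i + 2 * j) % (r + 1)`.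
  have hcycle : ∀ j, ∃ k ≥ a, (m k).O = ∅ ∧ (m k).i % (r + 1) = ((m a).i + 2 * j) % (r + 1) := by
    intro j
    induction j with
    | zero => exact ⟨a, le_rfl, hOa, rfl⟩
    | succ j ih =>
      obtain ⟨k, hk, hOk, hik⟩ := ih
      have hi1 : (m (k + 1)).i = ((m k).i + 2) % (r + 1) := by
        rcases (hstep k (ha.trans hk)).2.2.2.2 with h | h
        · rw [h.2.1, hrank (k + 1) (by omega)]
        · exact absurd hOk h.1
      have hex : ∃ l, l ≥ k + 1 ∧ (m l).O = ∅ := hO (k + 1)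
      classical
      obtain ⟨hl, hOl⟩ := Nat.find_spec hex
      have hconst : ∀ l ≥ k + 1, l ≤ Nat.find hex → (m l).i = (m (k + 1)).i := by
        intro l hl
        induction l, hl using Nat.le_induction with
        | base => exact fun _ => rfl
        | succ l hl ih =>
          intro hlt
          have hne : (m l).O ≠ ∅ := fun h => Nat.find_min hex (by omega : l < _) ⟨hl, h⟩
          rcases (hstep l (by omega)).2.2.2.2 with h | h
          · exact absurd h.1 hne
          · rw [h.2.1, ih (by omega)]
      refine ⟨Nat.find hex, by omega, hOl, ?_⟩
      rw [hconst _ hl le_rfl, hi1, Nat.mod_mod, Nat.add_mod, hik, ← Nat.add_mod]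
      congr 1
  -- Here `j` is chosen such that `(m a).i + 2 * (j + 1) = v + (r + 1) * ((m a).i + 1)`.
  obtain ⟨b, hb, hOb, hib⟩ := hcycle ((v + (r + 1) * ((m a).i + 1) - (m a).i) / 2 - 1)
  have hj : (m a).i + 2 * ((v + (r + 1) * ((m a).i + 1) - (m a).i) / 2 - 1) + 2 =
      v + (r + 1) * ((m a).i + 1) := by
    obtain ⟨x, hx⟩ := hia
    obtain ⟨y, hy⟩ := hrodd
    obtain ⟨z, hz⟩ := heven
    have : (r + 1) * ((m a).i + 1) = 2 * ((y + 1) * ((m a).i + 1)) := by rw [hy]; ring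
    have h2 : (m a).i + 1 ≤ (y + 1) * ((m a).i + 1) := Nat.le_mul_of_pos_left _ (by omega)
    omega
  have hib1 : (m (b + 1)).i = v ∧ (m (b + 1)).O = (m (b + 1)).S ∩ (m (b + 1)).f ⁻¹' {v} := by
    rcases (hstep b (ha.trans hb)).2.2.2.2 with h | h
    · have : (m (b + 1)).i = v := by
        rw [h.2.1, hrank (b + 1) (by omega), Nat.add_mod, hib, ← Nat.add_mod, hj,
          Nat.add_mul_mod_self_left, Nat.mod_eq_of_lt (by omega)]
      exact ⟨this, by rw [h.2.2, this]⟩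
    · exact absurd hOb h.1
  have hmem : ∀ k ≥ b + 1, (m k).i = v ∧ τ k ∈ (m k).O := by
    intro k hk
    induction k, hk using Nat.le_induction with
    | base =>
      refine ⟨hib1.1, ?_⟩
      rw [hib1.2, hS (b + 1) (by omega)]
      exact ⟨(hτ (b + 1) (by omega)).1, hv (b + 1) (by omega)⟩
    | succ k hk ih =>
      rcases (hstep k (by omega)).2.2.2.2 with h | h
      · exact absurd h.1 (Set.nonempty_iff_ne_empty.1 ⟨_, ih.2⟩)
      · refine ⟨h.2.1.trans ih.1, ?_⟩
        rw [h.2.2, ih.1]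
        exact ⟨mem_post.2 ⟨_, ih.2, (hτ k (by omega)).2⟩, hv (k + 1) (by omega)⟩
  obtain ⟨k, hk, hOk⟩ := hO (b + 1)
  exact Set.notMem_empty _ (hOk ▸ (hmem k hk).2)

/-- The rankings along an accepting sequence of macrostates form an odd ranking, if the levels
before the sequence starts get the largest value that is allowed. -/
theorem exists_isOddRanking {m : ℕ → Macrostate Q} {N : ℕ}
    (hS : ∀ k ≥ N, (m k).S = A.reach w k) (hQ : ∀ k ≥ N, m k ∈ A.Q₂)
    (hstep : ∀ k ≥ N, A.macroStep (m k) (w k) (m (k + 1)))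
    (hO : ∀ n, ∃ k ≥ n, (m k).O = ∅) :
    ∃ f, A.IsOddRanking w f ∧ ∀ k q, f k q ≤ 2 * Fintype.card Q := by
  have hb : ∀ k ≥ N, ∀ q, (m k).f q ≤ 2 * Fintype.card Q := fun k hk => (hQ k hk).1.1.1
  refine ⟨fun k q => if k < N then 2 * Fintype.card Q else (m k).f q,
    ⟨fun k q hq q' hq' => ?_, fun k q hq hF => ?_, fun K τ v hτ hv => ?_⟩, fun k q => ?_⟩
  · split_ifs with h1 h2 h2
    · exact le_rfl
    · omega
    · exact hb _ (by omega) _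
    · exact (hstep k (by omega)).2.1 q (hS k (by omega) ▸ hq) q' hq'
  · split_ifs with h
    · exact even_two_mul _
    · exact (hQ k (by omega)).1.1.2 q hF
  · have hN : ∀ k ≥ max K N, k ≥ N := fun k hk => (le_max_right _ _).trans hk
    refine odd_of_macroStep_path (m := m) (fun k hk => hS k (hN k hk)) (fun k hk => hQ k (hN k hk))
      (fun k hk => hstep k (hN k hk)) hO (hτ.mono (le_max_left K N)) fun k hk => ?_
    have h := hv k ((le_max_left _ _).trans hk)
    rwa [if_neg (by have := hN k hk; omega)] at h
  · dsimp only
    split_ifs with h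
    exacts [le_rfl, hb k (by omega) q]

/-! ### Runs of Schewe's construction -/

theorem IsAccepting.exists_ge {α' Q' : Type*} {B : BuchiAutomaton α' Q'} {ρ : ℕ → Q'}
    (h : B.IsAccepting ρ) (n : ℕ) : ∃ k ≥ n, ρ k ∈ B.F := by
  obtain ⟨q, hq, hinf⟩ := h
  obtain ⟨k, hk, hnk⟩ := hinf.exists_gt n
  exact ⟨k, hnk.le, by rw [hk]; exact hq⟩

/-- With finitely many states, visiting the accepting states infinitely often means visiting one of
them infinitely often. -/
theorem isAccepting_of_forall_exists_ge {α' Q' : Type*} [Finite Q'] {B : BuchiAutomaton α' Q'}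
    {ρ : ℕ → Q'} (h : ∀ n, ∃ k ≥ n, ρ k ∈ B.F) : B.IsAccepting ρ := by
  by_contra hna
  have hfin : ∀ q ∈ B.F, {i | ρ i = q}.Finite := fun q hq =>
    Set.not_infinite.1 fun hinf => hna ⟨q, hq, hinf⟩
  have : (⋃ q ∈ B.F, {i | ρ i = q}).Finite := (Set.toFinite B.F).biUnion hfin
  refine Set.infinite_of_forall_exists_gt (s := ⋃ q ∈ B.F, {i | ρ i = q}) (fun n => ?_) this
  obtain ⟨k, hk, hF⟩ := h (n + 1)
  exact ⟨k, by simpa using hF, hk⟩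

theorem scheweWith_language_mono {M M' : Set (Macrostate Q)} (h : M ⊆ M') :
    (A.scheweWith M).language ⊆ (A.scheweWith M').language := by
  intro w hw
  obtain ⟨x, hx, ρ, ⟨h0, hρ⟩, q, hqF, hinf⟩ := Set.mem_iUnion₂.1 hw
  refine Set.mem_iUnion₂.2 ⟨x.map id (Set.inclusion h), ?_, fun k => (ρ k).map id (Set.inclusion h),
    ⟨congrArg _ h0, fun k => ?_⟩, q.map id (Set.inclusion h), ?_,
    hinf.mono fun k hk => congrArg (Sum.map id (Set.inclusion h)) hk⟩
  · rw [Set.mem_singleton_iff.1 hx]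
    rfl
  · have := hρ k
    change A.scheweStep M (ρ k) (w k) (ρ (k + 1)) at this
    change A.scheweStep M' ((ρ k).map id _) (w k) ((ρ (k + 1)).map id _)
    rcases h1 : ρ k with S | m <;> rcases h2 : ρ (k + 1) with S' | m' <;>
      rw [h1, h2] at this <;> exact this
  · rcases hqF with hq | ⟨m, rfl, hm⟩
    · rw [Set.mem_singleton_iff.1 hq]
      exact Or.inl rfl
    · exact Or.inr ⟨Set.inclusion h m, rfl, hm⟩

/-- A run that stays in the first part of the state space visits the sets `A.reach w k`, and it is
accepting iff these are empty infinitely often. A run that enters the second part yields a sequence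
of macrostates, which is indexed here by the levels and has a junk value before level `N`. -/
theorem mem_language_scheweWith {M : Set (Macrostate Q)} (hw : w ∈ (A.scheweWith M).language) :
    (∀ n, ∃ k ≥ n, A.reach w k = ∅) ∨
    ∃ N, ∃ m : ℕ → Macrostate Q, (∀ k ≥ N, (m k).S = A.reach w k) ∧ (∀ k ≥ N, m k ∈ M) ∧
      (∀ k ≥ N, A.macroStep (m k) (w k) (m (k + 1))) ∧ ∀ n, ∃ k ≥ n, (m k).O = ∅ := by
  obtain ⟨x, hx, ρ, ⟨h0, hρ⟩, hacc⟩ := Set.mem_iUnion₂.1 hw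
  replace h0 : ρ 0 = .inl A.I := h0.trans hx
  replace hρ : ∀ k, A.scheweStep M (ρ k) (w k) (ρ (k + 1)) := hρ
  have hreach : ∀ k, (∀ S, ρ k = .inl S → S = A.reach w k) ∧
      ∀ m, ρ k = .inr m → m.1.S = A.reach w k := by
    intro k
    induction k with
    | zero => simp [h0, reach, eq_comm]
    | succ k ih =>
      have := hρ k
      rcases h1 : ρ k with S | m <;> rcases h2 : ρ (k + 1) with S' | m' <;>
        rw [h1, h2] at this
      · refine ⟨fun T hT => ?_, by simp⟩
        rw [← Sum.inl.inj hT, show S' = _ from this, ih.1 S h1, reach]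
      · refine ⟨by simp, fun T hT => ?_⟩
        rw [← Sum.inr.inj hT, this.1, ih.1 S h1, reach]
      · exact this.elim
      · refine ⟨by simp, fun T hT => ?_⟩
        rw [← Sum.inr.inj hT, this.1, ih.2 m h1, reach]
  by_cases hinr : ∃ N m, ρ N = .inr m
  · right
    obtain ⟨N, m₀, hN⟩ := hinr
    have hm : ∀ k ≥ N, ∃ m, ρ k = .inr m := by
      intro k hk
      induction k, hk using Nat.le_induction with
      | base => exact ⟨m₀, hN⟩
      | succ k hk ih =>
        obtain ⟨m, hm⟩ := ih
        have := hρ k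
        rcases h2 : ρ (k + 1) with S' | m'
        · rw [hm, h2] at this
          exact this.elim
        · exact ⟨m', rfl⟩
    have : Nonempty M := ⟨m₀⟩
    choose! m hm using hm
    refine ⟨N, fun k => (m k).1, fun k hk => (hreach k).2 _ (hm k hk), fun k _ => (m k).2,
      fun k hk => ?_, fun n => ?_⟩
    · have := hρ k
      rwa [hm k hk, hm (k + 1) (by omega)] at this
    · obtain ⟨k, hk, hF⟩ := hacc.exists_ge (max n N)
      rw [hm k ((le_max_right _ _).trans hk)] at hF
      refine ⟨k, (le_max_left _ _).trans hk, ?_⟩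
      rcases hF with h | ⟨m', h, hO⟩
      · cases h
      · change (m k).1.O = ∅
        rw [Sum.inr.inj h]
        exact hO
  · left
    intro n
    obtain ⟨k, hk, hF⟩ := hacc.exists_ge n
    rcases hF with h | ⟨m', h, -⟩
    · exact ⟨k, hk, ((hreach k).1 _ h).symm⟩
    · exact absurd ⟨k, m', h⟩ hinr

theorem mem_language_scheweWith_of_reach_eq_empty {M : Set (Macrostate Q)}
    (h : ∀ n, ∃ k ≥ n, A.reach w k = ∅) : w ∈ (A.scheweWith M).language := by
  refine Set.mem_iUnion₂.2 ⟨.inl A.I, rfl, fun k => .inl (A.reach w k), ⟨rfl, fun k => rfl⟩,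
    .inl ∅, Or.inl rfl, Set.infinite_of_forall_exists_gt fun n => ?_⟩
  obtain ⟨k, hk, e⟩ := h (n + 1)
  exact ⟨k, by simp [e], hk⟩

/-- An accepting run that goes through the sets `A.reach w k` up to level `N` and then follows a
given sequence of macrostates. The switch is made at level `N + 1` because the initial state of the
construction lies in its first part. -/
theorem mem_language_scheweWith_of_macroStep {M : Set (Macrostate Q)} [Finite M]
    {m : ℕ → Macrostate Q} {N : ℕ} (hS : ∀ k ≥ N + 1, (m k).S = A.reach w k)
    (hM : ∀ k ≥ N + 1, m k ∈ M) (hstep : ∀ k ≥ N + 1, A.macroStep (m k) (w k) (m (k + 1)))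
    (hO₀ : (m (N + 1)).O = ∅) (hi₀ : (m (N + 1)).i = 0)
    (ht₀ : IsTightOn (m (N + 1)).S (m (N + 1)).f) (hO : ∀ n, ∃ k ≥ n, (m k).O = ∅) :
    w ∈ (A.scheweWith M).language := by
  let ρ : ℕ → Set Q ⊕ M := fun k =>
    if h : k ≥ N + 1 then .inr ⟨m k, hM k h⟩ else .inl (A.reach w k)
  refine Set.mem_iUnion₂.2 ⟨.inl A.I, rfl, ρ, ⟨by simp [ρ, reach], fun k => ?_⟩,
    isAccepting_of_forall_exists_ge fun n => ?_⟩
  · change A.scheweStep M (ρ k) (w k) (ρ (k + 1))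
    rcases lt_trichotomy k N with hk | rfl | hk
    · simp only [ρ, dif_neg (show ¬ k ≥ N + 1 by omega), dif_neg (show ¬ k + 1 ≥ N + 1 by omega)]
      rfl
    · simp only [ρ, dif_neg (show ¬ k ≥ k + 1 by omega), dif_pos (show k + 1 ≥ k + 1 by omega)]
      exact ⟨hS _ le_rfl, hO₀, ht₀, hi₀⟩
    · simp only [ρ, dif_pos (show k ≥ N + 1 by omega), dif_pos (show k + 1 ≥ N + 1 by omega)]
      exact hstep k hk
  · obtain ⟨k, hk, e⟩ := hO (max n (N + 1))
    have hkN : k ≥ N + 1 := (le_max_right _ _).trans hk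
    exact ⟨k, (le_max_left _ _).trans hk, Or.inr ⟨⟨m k, hM k hkN⟩, dif_pos hkN, e⟩⟩

end Complement

/-! ### The accepting run of the least odd ranking -/

section BreakpointRun

variable {α Q : Type*} {A : BuchiAutomaton α Q} {w : ℕ → α}

open Classical in
/-- The run of Schewe's construction over `w` that starts in level `N` with the macrostate
`(S, ∅, f N, 0)` and uses the rankings `f k` of rank `r`; the components `O` and `i` are then
determined. The argument `j` is the distance from level `N`. -/
noncomputable def breakpointRun (A : BuchiAutomaton α Q) (w : ℕ → α) (f : ℕ → Q → ℕ) (r N : ℕ) :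
    ℕ → Macrostate Q
  | 0 => ⟨A.reach w N, ∅, f N, 0⟩
  | j + 1 =>
    let m := breakpointRun A w f r N j
    if m.O = ∅ then
      ⟨A.reach w (N + (j + 1)), A.reach w (N + (j + 1)) ∩ f (N + (j + 1)) ⁻¹' {(m.i + 2) % (r + 1)},
        f (N + (j + 1)), (m.i + 2) % (r + 1)⟩
    else
      ⟨A.reach w (N + (j + 1)), A.post m.O (w (N + j)) ∩ f (N + (j + 1)) ⁻¹' {m.i},
        f (N + (j + 1)), m.i⟩

theorem breakpointRun_S (f : ℕ → Q → ℕ) (r N j : ℕ) :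
    (breakpointRun A w f r N j).S = A.reach w (N + j) := by
  cases j with
  | zero => rfl
  | succ j => rw [breakpointRun]; split_ifs <;> rfl

theorem breakpointRun_f (f : ℕ → Q → ℕ) (r N j : ℕ) :
    (breakpointRun A w f r N j).f = f (N + j) := by
  cases j with
  | zero => rfl
  | succ j => rw [breakpointRun]; split_ifs <;> rfl

theorem breakpointRun_invariant (f : ℕ → Q → ℕ) {r : ℕ} (hr : Odd r) (N j : ℕ) :
    Even (breakpointRun A w f r N j).i ∧ (breakpointRun A w f r N j).i < r ∧
      (breakpointRun A w f r N j).O ⊆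
        A.reach w (N + j) ∩ f (N + j) ⁻¹' {(breakpointRun A w f r N j).i} := by
  induction j with
  | zero => exact ⟨Even.zero, hr.pos, Set.empty_subset _⟩
  | succ j ih =>
    obtain ⟨h1, h2, h3⟩ := ih
    rw [breakpointRun]
    split_ifs with h
    · have hev : Even (((breakpointRun A w f r N j).i + 2) % (r + 1)) :=
        (Even.mod_even_iff hr.add_one).2 (h1.add even_two)
      refine ⟨hev, ?_, le_rfl⟩
      have hlt := Nat.mod_lt ((breakpointRun A w f r N j).i + 2) (Nat.succ_pos r)
      refine lt_of_le_of_ne (Nat.lt_succ_iff.1 hlt) fun e => ?_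
      exact Nat.not_even_iff_odd.2 hr (e ▸ hev)
    · refine ⟨h1, h2, Set.inter_subset_inter_left _ fun q' hq' => ?_⟩
      obtain ⟨q, hq, hqq'⟩ := mem_post.1 hq'
      exact mem_reach_succ (h3 hq).1 hqq'

variable [Fintype Q]

theorem macroStep_breakpointRun {f : ℕ → Q → ℕ} (hf : A.IsOddRanking w f) {r N : ℕ}
    (ht : ∀ k ≥ N, rank (f k) = r ∧ IsTightOn (A.reach w k) (f k)) (j : ℕ) :
    A.macroStep (breakpointRun A w f r N j) (w (N + j)) (breakpointRun A w f r N (j + 1)) := by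
  have hS := breakpointRun_S (A := A) (w := w) f r N
  have hfj := breakpointRun_f (A := A) (w := w) f r N
  refine ⟨by rw [hS, hS]; rfl, ?_, ?_, ?_, ?_⟩
  · rw [hS, hfj, hfj]
    exact fun q hq q' hq' => hf.le_of_edge (N + j) q hq q' hq'
  · rw [hfj, hfj, (ht _ (by omega)).1, (ht _ (by omega)).1]
  · rw [hS, hfj]
    exact (ht _ (by omega)).2
  · rw [hfj, hS, (ht _ (by omega)).1, breakpointRun]
    split_ifs with h
    · exact Or.inl ⟨h, rfl, rfl⟩
    · exact Or.inr ⟨h, rfl, rfl⟩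

/-- The breakpoint set is emptied infinitely often; otherwise, by Kőnig's lemma, it would contain
a path that is trapped in an even value. -/
theorem exists_breakpointRun_O_eq_empty {f : ℕ → Q → ℕ} (hf : A.IsOddRanking w f) {r N : ℕ}
    (ht : ∀ k ≥ N, rank (f k) = r ∧ IsTightOn (A.reach w k) (f k)) (n : ℕ) :
    ∃ j ≥ n, (breakpointRun A w f r N j).O = ∅ := by
  have hr : Odd r := (ht N le_rfl).1 ▸ (ht N le_rfl).2.1
  by_contra! hne
  have hinv := breakpointRun_invariant (A := A) (w := w) f hr N
  have hstep : ∀ j ≥ n, (breakpointRun A w f r N (j + 1)).i = (breakpointRun A w f r N j).i ∧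
      (breakpointRun A w f r N (j + 1)).O ⊆
        A.post (breakpointRun A w f r N j).O (w (N + j)) := by
    intro j hj
    rcases (macroStep_breakpointRun hf ht j).2.2.2.2 with h | h
    · exact absurd h.1 (hne j hj).ne_empty
    · exact ⟨h.2.1, by rw [h.2.2]; exact Set.inter_subset_left⟩
  have hi : ∀ j ≥ n, (breakpointRun A w f r N j).i = (breakpointRun A w f r N n).i := by
    intro j hj
    induction j, hj using Nat.le_induction with
    | base => rfl
    | succ j hj ih => rw [(hstep j hj).1, ih]
  obtain ⟨τ, hτ⟩ := exists_path_of_forall_exists_pred (A := A) (w := w) (N := N + n)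
    (T := fun k => (breakpointRun A w f r N (k - N)).O)
    (fun k hk => hne _ (by omega))
    (fun k hk => by
      have := (hstep (k - N) (by omega)).2
      rwa [show N + (k - N) = k by omega, show k - N + 1 = k + 1 - N by omega] at this)
  have hmem : ∀ k ≥ N + n, τ k ∈ A.reach w k ∧ f k (τ k) = (breakpointRun A w f r N n).i := by
    intro k hk
    have := (hinv (k - N)).2.2 (hτ k hk).1
    rw [hi _ (by omega), show N + (k - N) = k by omega] at this
    exact this
  exact Nat.not_odd_iff_even.2 (hinv n).1 (hf.odd_of_path (N + n) τ _
    (fun k hk => ⟨(hmem k hk).1, (hτ k hk).2⟩) fun k hk => (hmem k hk).2)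

theorem breakpointRun_mem_Q₂ {f : ℕ → Q → ℕ} (hf : A.IsOddRanking w f)
    (hb : ∀ k q, f k q ≤ 2 * Fintype.card Q) {r N : ℕ}
    (ht : ∀ k ≥ N, rank (f k) = r ∧ IsTightOn (A.reach w k) (f k)) (j : ℕ) :
    breakpointRun A w f r N j ∈ A.Q₂ := by
  have htj := ht (N + j) (by omega)
  have hr : Odd r := htj.1 ▸ htj.2.1
  obtain ⟨h1, h2, h3⟩ := breakpointRun_invariant (A := A) (w := w) f hr N j
  have hrle : r ≤ 2 * Fintype.card Q := htj.1 ▸ Finset.sup_le fun q _ => hb _ q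
  refine ⟨⟨⟨?_, fun q hq => ?_⟩, ?_, fun k hk hkr => ?_, fun q hq => absurd (Set.mem_univ q) hq⟩,
    h1, ?_, ?_, ?_⟩
  · rw [breakpointRun_f]
    exact hb _
  · rw [breakpointRun_f]
    by_cases hqr : q ∈ A.reach w (N + j)
    · exact hf.even_of_mem _ q hqr hq
    · rw [htj.2.2.2 q hqr]
      exact Even.zero
  · rw [breakpointRun_f]
    exact htj.2.1
  · rw [breakpointRun_f] at hkr ⊢
    obtain ⟨s, -, e⟩ := htj.2.2.1 k hk hkr
    exact ⟨s, Set.mem_univ s, e⟩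
  · grind
  · rw [breakpointRun_f, breakpointRun_S]
    exact htj.2
  · rw [breakpointRun_f, breakpointRun_S]
    exact h3

/-- The least odd ranking is monotone for direct simulation, so none of its macrostates is purged. -/
theorem mem_language_purgeDi [Nonempty α] (hA : A.IsComplete) {f : ℕ → Q → ℕ}
    (hf : A.IsOddRanking w f) (hb : ∀ k q, f k q ≤ 2 * Fintype.card Q)
    (hne : ∀ k, (A.reach w k).Nonempty) : w ∈ A.purgeDi.language := by
  have hex : ∃ f, A.IsOddRanking w f := ⟨f, hf⟩
  have hμ := isOddRanking_leastRanking hex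
  have hμb : ∀ k q, A.leastRanking w k q ≤ 2 * Fintype.card Q := fun k q =>
    (leastRanking_le hf k q).trans (hb k q)
  obtain ⟨r, hr⟩ := eventually_tight_leastRanking hex hne
  obtain ⟨N, hN⟩ := Filter.eventually_atTop.1 hr
  have ht : ∀ k ≥ N + 1, rank (A.leastRanking w k) = r ∧
      IsTightOn (A.reach w k) (A.leastRanking w k) := fun k hk => hN k (by omega)
  let m : ℕ → Macrostate Q := fun k =>
    breakpointRun A w (A.leastRanking w) r (N + 1) (k - (N + 1))
  have hS : ∀ k ≥ N + 1, (m k).S = A.reach w k := fun k hk => by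
    simp only [m, breakpointRun_S]
    congr 1
    omega
  refine mem_language_scheweWith_of_macroStep (m := m) (N := N) hS (fun k hk => ⟨?_, ?_⟩)
    (fun k hk => ?_) ?_ ?_ ?_ fun n => ?_
  · exact breakpointRun_mem_Q₂ hμ hμb ht _
  · rintro ⟨-, p, -, q, hq, hpq, hlt⟩
    rw [hS k hk] at hq
    simp only [m, breakpointRun_f, show N + 1 + (k - (N + 1)) = k by omega] at hlt
    exact hlt.not_ge (leastRanking_le_of_directSim hA hex hq hpq)
  · have := macroStep_breakpointRun hμ ht (k - (N + 1))
    rwa [show N + 1 + (k - (N + 1)) = k by omega,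
      show k - (N + 1) + 1 = k + 1 - (N + 1) by omega] at this
  · simp [m, breakpointRun]
  · simp [m, breakpointRun]
  · simpa [m, breakpointRun] using (ht (N + 1) le_rfl).2
  · obtain ⟨j, hj, e⟩ := exists_breakpointRun_O_eq_empty hμ ht n
    exact ⟨N + 1 + j, by omega, by simpa [m] using e⟩

end BreakpointRun

end BuchiAutomaton

open BuchiAutomaton in
theorem lemma1 {α Q : Type*} [Finite α] [Nonempty α] [Fintype Q]
    (A : BuchiAutomaton α Q) (hA : A.IsComplete) :
    A.purgeDi.language = A.compSchewe.language := by
  refine Set.Subset.antisymm (scheweWith_language_mono Set.sdiff_subset) fun w hw => ?_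
  rcases mem_language_scheweWith hw with h | ⟨N, m, hS, hQ, hstep, hO⟩
  · exact mem_language_scheweWith_of_reach_eq_empty h
  · obtain ⟨f, hf, hb⟩ := exists_isOddRanking hS hQ hstep hO
    refine mem_language_purgeDi hA hf hb fun k => ?_
    -- An empty level would be followed by empty levels only, on which no ranking is tight.
    by_contra hk
    rw [Set.not_nonempty_iff_eq_empty] at hk
    have hempty : ∀ l ≥ k, A.reach w l = ∅ := by
      intro l hl
      induction l, hl using Nat.le_induction with
      | base => exact hk
      | succ l hl ih => simp [reach, post, ih]
    have hmax := hQ (max k N) (le_max_right _ _)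
    obtain ⟨s, hs, -⟩ := hmax.2.2.2.1.2.1 1 odd_one hmax.2.2.2.1.1.pos
    rw [hS _ (le_max_right _ _), hempty _ (le_max_left _ _)] at hs
    exact hs
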